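/- Fix real numbers $\ell>0$, $w>0$ and $b\neq 0$. Let $R(x,y,z)=(x,-y,-z)$. **Starting arc.** Let $f_0\colon[0,1]\to\mathbb R^3$ be the wedge made of two straight segments that meet in the vertex $0$: for $0\le s\le 2$, $$f_0\!\left(\tfrac12-\tfrac s4\right)=(-6\ell s,\;ws,\;0),\qquad f_0\!\left(\tfrac12+\tfrac s4\right)=(-6\ell s,\;-ws,\;0).$$ **Inserting nested twists.** A single Reidemeister I twist of length $3\ell$ consists of the polygonal strand $(-6\ell s,\tau(s))$, $\tfrac12\le s\le1$, and its image under $R$, where $\tau\colon[\tfrac12,1]\to\mathbb R^2$ is affine on $[\tfrac12,\tfrac34]$ and on $[\tfrac34,1]$ with $\tau(1)=(w,0)$, $\tau(\tfrac34)=(0,b)$, $\tau(\tfrac12)=(-\tfrac w2,0)$; the two strands exchange sides, crossing once in the projection to the $(x,y)$-plane. Define $\sigma_n\colon[0,2]\to\mathbb R^2$ by $\sigma_0(s)=(ws,0)$ and $$\sigma_{n+1}(s)=\begin{cases}(ws,0)& s\ge 1,\\ \tau(s)& \tfrac12\le s<1,\\ -\tfrac12\,\sigma_n(2s)& s<\tfrac12,\end{cases}$$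 so that the first twist is inserted in the wedge, and a half-scale copy of the wedge with the remaining $n$ twists (turned by $R$) is put at its tip. Let $f^{(n)}\colon[0,1]\to\mathbb R^3$ be given by $$f^{(n)}\!\left(\tfrac12-\tfrac s4\right)=(-6\ell s,\;\sigma_n(s)),\qquad f^{(n)}\!\left(\tfrac12+\tfrac s4\right)=(-6\ell s,\;-\sigma_n(s))\qquad(0\le s\le 2);$$ this is $f_0$ with $n$ nested Reidemeister I twists inserted, each one a half-scale copy of the preceding one. Let $f_1=\lim_{n\to\infty}f^{(n)}$ be the arc with countably many twists, which accumulate only at the point $f_1(\tfrac12)=0$. **Proposition.** The maps $f_0$ and $f_1$ are embeddings, $f^{(n)}\to f_1$ uniformly, and $f_0\cong f_1$: there is a homeomorphism $h\colon\mathbb R^3\to\mathbb R^3$ with $h\circ f_0=f_1$. Moreover there is an ambient isotopy from $f_0$ to $f_1$, that is, a continuous map $H\colon[0,1]\times\mathbb R^3\to\mathbb R^3$ such that $H(0,\cdot)$ is the identity, every $H(t,\cdot)$ is a homeomorphism of $\mathbb R^3$, and $H(1,f_0(x))=f_1(x)$ for all $x\in[0,1]$. -/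

import Mathlib

open Topology Filter

/-- `H : [0,1] × Y → Y` is an ambient isotopy from `f₁` to `f₂`. -/
structure IsAmbientIsotopy {X Y : Type*} [TopologicalSpace X] [TopologicalSpace Y]
    (f₁ f₂ : X → Y) (H : unitInterval × Y → Y) : Prop where
  continuous : Continuous H
  zero_eq : ∀ y, H (0, y) = y
  isHomeomorph : ∀ t, IsHomeomorph fun y => H (t, y)
  one_eq : ∀ x, H (1, f₁ x) = f₂ x

/-- There is an ambient isotopy from `f₁` to `f₂`. -/
def AmbientIsotopic {X Y : Type*} [TopologicalSpace X] [TopologicalSpace Y]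
    (f₁ f₂ : X → Y) : Prop :=
  ∃ H : unitInterval × Y → Y, IsAmbientIsotopy f₁ f₂ H

/-- Equivalence `f₁ ≅ f₂`: an ambient homeomorphism carries `f₁` to `f₂` pointwise. -/
def AmbientHomeomorphic {X Y : Type*} [TopologicalSpace X] [TopologicalSpace Y]
    (f₁ f₂ : X → Y) : Prop :=
  ∃ h : Y ≃ₜ Y, ∀ x, h (f₁ x) = f₂ x

/-- One strand of a wedge: at (rescaled) distance `s` from the vertex it has the transverse
coordinates `(y, z) = (w s, 0)`. The other strand is its image under `(y, z) ↦ (-y, -z)`. -/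
noncomputable def wedgeStrand (w : ℝ) (s : ℝ) : ℝ × ℝ := (w * s, 0)

/-- The transverse coordinates `(y, z)` of one strand of a single Reidemeister I twist, which
occupies `1/2 ≤ s ≤ 1`. It is polygonal, with the vertices `(w, 0)` at `s = 1`, `(0, b)` at
`s = 3/4` and `(-w/2, 0)` at `s = 1/2`. The other strand of the twist is its image under
`(y, z) ↦ (-y, -z)`, so the two strands exchange sides, one passing over the other at
`s = 3/4`, and then bound a loop that is closed up by the part `s < 1/2` of the arc. -/
noncomputable def twistStrand (w b : ℝ) (s : ℝ) : ℝ × ℝ :=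
  if 3 / 4 ≤ s then (w * (4 * s - 3), b * (4 - 4 * s))
  else (w * (2 * s - 3 / 2), b * (4 * s - 2))

/-- One strand of the wedge after `n` nested twists have been inserted at its vertex: the first
twist is put on `1/2 ≤ s ≤ 1`, and on `s < 1/2` there is the half-scale copy of the wedge with
the remaining twists. In that copy this strand is the one on the other side, because
the strands have been exchanged by the first twist; hence the minus sign. -/
noncomputable def nestedStrand (w b : ℝ) : ℕ → ℝ → ℝ × ℝ
  | 0, s => wedgeStrand w s
  | n + 1, s =>
    if 1 ≤ s then wedgeStrand w s
    else if 1 / 2 ≤ s then twistStrand w b s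
    else -((1 / 2 : ℝ) • nestedStrand w b n (2 * s))

/-- The strand with all of the countably many twists, as the limit of the finite stages. -/
noncomputable def infiniteStrand (w b : ℝ) (s : ℝ) : ℝ × ℝ :=
  limUnder atTop fun n : ℕ => nestedStrand w b n s

/-- The arc in `ℝ³` that comes in along the strand `σ` (for `0 ≤ t ≤ 1/2`, with `s` going from
`2` down to `0`) and goes out along its image under the half-turn `(x, y, z) ↦ (x, -y, -z)`
(for `1/2 ≤ t ≤ 1`). The position along the axis is `x = -6 ℓ s`. -/
noncomputable def arcOfStrand (l : ℝ) (σ : ℝ → ℝ × ℝ) (t : unitInterval) :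
    EuclideanSpace ℝ (Fin 3) :=
  if (t : ℝ) ≤ 1 / 2 then
    !₂[-6 * l * (2 - 4 * (t : ℝ)), (σ (2 - 4 * (t : ℝ))).1, (σ (2 - 4 * (t : ℝ))).2]
  else
    !₂[-6 * l * (4 * (t : ℝ) - 2), -(σ (4 * (t : ℝ) - 2)).1, -(σ (4 * (t : ℝ) - 2)).2]

/-- The starting arc: two straight segments that meet in a vertex at the origin. -/
noncomputable def startingArc (l w : ℝ) : unitInterval → EuclideanSpace ℝ (Fin 3) :=
  arcOfStrand l (wedgeStrand w)

/-- The arc after the first `n` twists. -/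
noncomputable def finiteTwistArc (l w b : ℝ) (n : ℕ) :
    unitInterval → EuclideanSpace ℝ (Fin 3) :=
  arcOfStrand l (nestedStrand w b n)

/-- The arc with countably many nested half-scale twists. -/
noncomputable def infiniteTwistArc (l w b : ℝ) : unitInterval → EuclideanSpace ℝ (Fin 3) :=
  arcOfStrand l (infiniteStrand w b)

/-!
Fix the level planes `x = const`, write `s` for the rescaled distance from the vertex along the
axis, and identify the transverse plane with `ℂ` in units of `w`. Then the wedge consists of the
points `(s, s)` and `(s, -s)`, and the arc with infinitely many twists of the points `(s, ζ s)` and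
`(s, -ζ s)`. Each twist is a half-scale copy of the preceding one, so the strand stays between two
cones: `‖ζ s‖ / s` lies between two positive constants
(`norm_infiniteStrand_le`, `le_norm_infiniteStrand`). Hence `s ↦ ζ s / s` is a path in
`ℂ \ {0}` on `(0, ∞)`, and it has a continuous logarithm `L` with bounded real part
(`exists_continuousOn_log`); its imaginary part tends to infinity in absolute value at the vertex.

Multiplication by `exp (t * L s)` on the level `s > 0`, for `t` from `0` to `1`, moves the wedge to
the twisted arc, but does not extend continuously to the plane `s = 0`. The map `coneTwist`
therefore damps it: `L s` is multiplied by a cutoff of `‖v‖ / s`, which is `1` up to the wedge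
and vanishes outside a wider cone. All the twisting then takes place in a cone that meets
the plane `s = 0` in the vertex only, and since the moduli change by a bounded factor, the map is
continuous at the vertex too (`continuous_coneTwist`). The imaginary part of `L` only rotates
circles in the level planes; the real part stretches radii, and this stays injective because the
cutoff is a function of `log (‖v‖ / s)` of small slope (`strictMonoOn_mul_exp_logCutoff`). The maps
are proper, hence homeomorphisms (`isHomeomorph_coneTwist`).

The twisted arc is the image of the wedge under the time-one map, so that it is an embedding
because the wedge is. The uniform convergence of the finite stages is the geometric estimate
`norm_nestedStrand_sub_infiniteStrand_le`.
-/

/-! ### The strands -/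

theorem nestedStrand_of_one_le (w b : ℝ) (n : ℕ) {s : ℝ} (hs : 1 ≤ s) :
    nestedStrand w b n s = wedgeStrand w s := by
  cases n <;> simp [nestedStrand, hs]

theorem nestedStrand_succ_of_mem_Icc (w b : ℝ) (n : ℕ) {s : ℝ} (h₁ : 1 / 2 ≤ s) (h₂ : s ≤ 1) :
    nestedStrand w b (n + 1) s = twistStrand w b s := by
  rcases h₂.lt_or_eq with h | rfl
  · rw [nestedStrand, if_neg (not_le.2 h), if_pos h₁]
  · rw [nestedStrand_of_one_le w b _ le_rfl]
    norm_num [wedgeStrand, twistStrand]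

theorem nestedStrand_succ_of_le_half (w b : ℝ) (n : ℕ) {s : ℝ} (hs : s ≤ 1 / 2) :
    nestedStrand w b (n + 1) s = -((1 / 2 : ℝ) • nestedStrand w b n (2 * s)) := by
  rcases hs.lt_or_eq with h | rfl
  · rw [nestedStrand, if_neg (by linarith), if_neg (not_le.2 h)]
  · rw [nestedStrand_succ_of_mem_Icc w b n le_rfl (by norm_num),
      nestedStrand_of_one_le w b n (by norm_num)]
    norm_num [wedgeStrand, twistStrand]
    ring

theorem continuous_wedgeStrand (w : ℝ) : Continuous (wedgeStrand w) := by
  unfold wedgeStrand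
  fun_prop

theorem continuous_twistStrand (w b : ℝ) : Continuous (twistStrand w b) := by
  unfold twistStrand
  refine Continuous.if_le (by fun_prop) (by fun_prop) continuous_const continuous_id ?_
  rintro s rfl
  norm_num

theorem continuous_nestedStrand (w b : ℝ) (n : ℕ) : Continuous (nestedStrand w b n) := by
  induction n with
  | zero => exact continuous_wedgeStrand w
  | succ n ih =>
    have h : nestedStrand w b (n + 1) = fun s => if 1 ≤ s then wedgeStrand w s
        else if 1 / 2 ≤ s then twistStrand w b s
        else -((1 / 2 : ℝ) • nestedStrand w b n (2 * s)) := by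
      ext1 s
      rw [nestedStrand]
    rw [h]
    refine Continuous.if_le (continuous_wedgeStrand w) (Continuous.if_le
      (continuous_twistStrand w b) (by fun_prop) continuous_const continuous_id ?_)
      continuous_const continuous_id ?_
    · rintro s rfl
      rw [← nestedStrand_succ_of_mem_Icc w b n le_rfl (by norm_num),
        nestedStrand_succ_of_le_half w b n le_rfl]
    · rintro s rfl
      norm_num [wedgeStrand, twistStrand]

theorem norm_twistStrand_le (w b : ℝ) {s : ℝ} (_ : 1 / 2 ≤ s) (h₂ : s ≤ 1) :
    ‖twistStrand w b s‖ ≤ 2 * (|w| + |b|) * s := by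
  have hw := abs_nonneg w
  have hb := abs_nonneg b
  have key : ∀ x y : ℝ, |x| ≤ 1 → |y| ≤ 1 → ‖(w * x, b * y)‖ ≤ 2 * (|w| + |b|) * s := by
    intro x y hx hy
    rw [Prod.norm_def, Real.norm_eq_abs, Real.norm_eq_abs, abs_mul, abs_mul]
    refine max_le ?_ ?_ <;> nlinarith
  unfold twistStrand
  split_ifs with h
  · apply key <;> rw [abs_le] <;> constructor <;> linarith
  · apply key <;> rw [abs_le] <;> constructor <;> linarith

theorem le_norm_twistStrand (w b : ℝ) {s : ℝ} (_ : 1 / 2 ≤ s) (h₂ : s ≤ 1) :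
    min |w| |b| / 4 * s ≤ ‖twistStrand w b s‖ := by
  have hm : 0 ≤ min |w| |b| := by positivity
  have hw := min_le_left |w| |b|
  have hb := min_le_right |w| |b|
  -- Along the strand the two coordinates, in units of `w` and `b`, are never both small.
  have key : ∀ x y : ℝ, 1 / 4 ≤ |x| ∨ 1 / 4 ≤ |y| →
      min |w| |b| / 4 * s ≤ ‖(w * x, b * y)‖ := by
    intro x y h
    rw [Prod.norm_def, Real.norm_eq_abs, Real.norm_eq_abs, abs_mul, abs_mul]
    rcases h with h | h
    · exact le_max_of_le_left (by nlinarith)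
    · exact le_max_of_le_right (by nlinarith)
  unfold twistStrand
  split_ifs with h
  · apply key
    rcases le_total s (7 / 8) with h' | h'
    · exact Or.inr ((by linarith : (1 : ℝ) / 4 ≤ 4 - 4 * s).trans (le_abs_self _))
    · exact Or.inl ((by linarith : (1 : ℝ) / 4 ≤ 4 * s - 3).trans (le_abs_self _))
  · apply key
    rcases le_total s (5 / 8) with h' | h'
    · exact Or.inl ((by linarith : (1 : ℝ) / 4 ≤ -(2 * s - 3 / 2)).trans (neg_le_abs _))
    · exact Or.inr ((by linarith : (1 : ℝ) / 4 ≤ 4 * s - 2).trans (le_abs_self _))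

/-- The strand stays inside a cone, uniformly in the number of twists: the half-scale
self-similarity preserves a bound that is proportional to `s`. -/
theorem norm_nestedStrand_le (w b : ℝ) (n : ℕ) {s : ℝ} (hs : 0 ≤ s) :
    ‖nestedStrand w b n s‖ ≤ 2 * (|w| + |b|) * s := by
  have wedge : ∀ s : ℝ, 0 ≤ s → ‖wedgeStrand w s‖ ≤ 2 * (|w| + |b|) * s := by
    intro s hs
    have := mul_nonneg (abs_nonneg w) hs
    have := mul_nonneg (abs_nonneg b) hs
    rw [wedgeStrand, Prod.norm_def, Real.norm_eq_abs, norm_zero, abs_mul, abs_of_nonneg hs]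
    exact max_le (by linarith) (by linarith)
  induction n generalizing s with
  | zero => exact wedge s hs
  | succ n ih =>
    rcases le_total 1 s with h | h
    · rw [nestedStrand_of_one_le w b _ h]
      exact wedge s hs
    rcases le_total (1 / 2) s with h' | h'
    · rw [nestedStrand_succ_of_mem_Icc w b n h' h]
      exact norm_twistStrand_le w b h' h
    · rw [nestedStrand_succ_of_le_half w b n h', norm_neg, norm_smul]
      have := ih (s := 2 * s) (by linarith)
      norm_num
      linarith

/-- The strand stays outside a narrower cone, uniformly in the number of twists. -/
theorem le_norm_nestedStrand (w b : ℝ) (n : ℕ) {s : ℝ} (hs : 0 ≤ s) :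
    min |w| |b| / 4 * s ≤ ‖nestedStrand w b n s‖ := by
  have wedge : ∀ s : ℝ, 0 ≤ s → min |w| |b| / 4 * s ≤ ‖wedgeStrand w s‖ := by
    intro s hs
    have := mul_le_mul_of_nonneg_right (min_le_left |w| |b|) hs
    have := mul_nonneg (abs_nonneg w) hs
    rw [wedgeStrand, Prod.norm_def, Real.norm_eq_abs, abs_mul, abs_of_nonneg hs]
    exact le_max_of_le_left (by linarith)
  induction n generalizing s with
  | zero => exact wedge s hs
  | succ n ih =>
    rcases le_total 1 s with h | h
    · rw [nestedStrand_of_one_le w b _ h]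
      exact wedge s hs
    rcases le_total (1 / 2) s with h' | h'
    · rw [nestedStrand_succ_of_mem_Icc w b n h' h]
      exact le_norm_twistStrand w b h' h
    · rw [nestedStrand_succ_of_le_half w b n h', norm_neg, norm_smul]
      have := ih (s := 2 * s) (by linarith)
      norm_num
      linarith

/-- Two finite stages agree outside the innermost wedge of the coarser one, which is a copy at
scale `(1 / 2) ^ n`. -/
theorem norm_nestedStrand_sub_le (w b : ℝ) {n m : ℕ} (hnm : n ≤ m) {s : ℝ} (hs : 0 ≤ s) :
    ‖nestedStrand w b n s - nestedStrand w b m s‖ ≤ 4 * (|w| + |b|) * (1 / 2) ^ n := by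
  have hw := abs_nonneg w
  have hb := abs_nonneg b
  have hpos : ∀ k : ℕ, 0 ≤ 4 * (|w| + |b|) * (1 / 2) ^ k := fun k => by positivity
  induction n generalizing m s with
  | zero =>
    rcases le_total 1 s with h | h
    · rw [nestedStrand_of_one_le w b _ h, nestedStrand_of_one_le w b _ h, sub_self, norm_zero]
      exact hpos 0
    · have h₁ := norm_nestedStrand_le w b 0 hs
      have h₂ := norm_nestedStrand_le w b m hs
      have := norm_sub_le (nestedStrand w b 0 s) (nestedStrand w b m s)
      rw [pow_zero]
      nlinarith
  | succ n ih =>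
    obtain ⟨m, rfl⟩ : ∃ k, m = k + 1 := ⟨m - 1, by omega⟩
    rcases le_total 1 s with h | h
    · rw [nestedStrand_of_one_le w b _ h, nestedStrand_of_one_le w b _ h, sub_self, norm_zero]
      exact hpos _
    rcases le_total (1 / 2) s with h' | h'
    · rw [nestedStrand_succ_of_mem_Icc w b n h' h, nestedStrand_succ_of_mem_Icc w b m h' h,
        sub_self, norm_zero]
      exact hpos _
    · rw [nestedStrand_succ_of_le_half w b n h', nestedStrand_succ_of_le_half w b m h',
        ← neg_sub', norm_neg, ← smul_sub, norm_smul, pow_succ]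
      have := ih (m := m) (by omega) (s := 2 * s) (by linarith)
      norm_num at this ⊢
      linarith

theorem tendsto_nestedStrand (w b : ℝ) {s : ℝ} (hs : 0 ≤ s) :
    Tendsto (fun n => nestedStrand w b n s) atTop (𝓝 (infiniteStrand w b s)) := by
  refine CauchySeq.tendsto_limUnder (cauchySeq_of_le_tendsto_0'
    (fun n => 4 * (|w| + |b|) * (1 / 2) ^ n) (fun n m hnm => ?_) ?_)
  · rw [dist_eq_norm]
    exact norm_nestedStrand_sub_le w b hnm hs
  · simpa using (tendsto_pow_atTop_nhds_zero_of_lt_one (r := (1 / 2 : ℝ)) (by norm_num)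
      (by norm_num)).const_mul (4 * (|w| + |b|))

theorem norm_nestedStrand_sub_infiniteStrand_le (w b : ℝ) (n : ℕ) {s : ℝ} (hs : 0 ≤ s) :
    ‖nestedStrand w b n s - infiniteStrand w b s‖ ≤ 4 * (|w| + |b|) * (1 / 2) ^ n :=
  le_of_tendsto (tendsto_const_nhds.sub (tendsto_nestedStrand w b hs)).norm
    (eventually_atTop.2 ⟨n, fun _ hm => norm_nestedStrand_sub_le w b hm hs⟩)

theorem tendstoUniformlyOn_nestedStrand (w b : ℝ) :
    TendstoUniformlyOn (nestedStrand w b) (infiniteStrand w b) atTop (Set.Ici 0) := by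
  rw [Metric.tendstoUniformlyOn_iff]
  intro ε hε
  have h : Tendsto (fun n : ℕ => 4 * (|w| + |b|) * (1 / 2 : ℝ) ^ n) atTop (𝓝 0) := by
    simpa using (tendsto_pow_atTop_nhds_zero_of_lt_one (r := (1 / 2 : ℝ)) (by norm_num)
      (by norm_num)).const_mul (4 * (|w| + |b|))
  filter_upwards [h.eventually_lt_const hε] with n hn s hs
  rw [dist_comm, dist_eq_norm]
  exact (norm_nestedStrand_sub_infiniteStrand_le w b n hs).trans_lt hn

/-- Only on `[0, ∞)`: for `s < 0` and `w ≠ 0` the finite stages alternate between `(w * s, 0)`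
and its negative, and `limUnder` takes a junk value. -/
theorem continuousOn_infiniteStrand (w b : ℝ) :
    ContinuousOn (infiniteStrand w b) (Set.Ici 0) :=
  (tendstoUniformlyOn_nestedStrand w b).continuousOn
    (Frequently.of_forall fun n => (continuous_nestedStrand w b n).continuousOn)

theorem norm_infiniteStrand_le (w b : ℝ) {s : ℝ} (hs : 0 ≤ s) :
    ‖infiniteStrand w b s‖ ≤ 2 * (|w| + |b|) * s :=
  le_of_tendsto' (tendsto_nestedStrand w b hs).norm fun n => norm_nestedStrand_le w b n hs

theorem le_norm_infiniteStrand (w b : ℝ) {s : ℝ} (hs : 0 ≤ s) :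
    min |w| |b| / 4 * s ≤ ‖infiniteStrand w b s‖ :=
  ge_of_tendsto' (tendsto_nestedStrand w b hs).norm fun n => le_norm_nestedStrand w b n hs

/-! ### Twisting a cone level by level -/

/-- A continuous cutoff on `[0, ∞)`: it is `1` on `[0, 1]`, vanishes from `exp (1 / ε)` on, and
in between decreases linearly in `log u`, with the small slope `ε`. -/
noncomputable def logCutoff (ε u : ℝ) : ℝ := max 0 (1 - ε * Real.log (max 1 u))

theorem continuous_logCutoff (ε : ℝ) : Continuous (logCutoff ε) := by
  unfold logCutoff
  have h : Continuous fun u : ℝ => Real.log (max 1 u) :=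
    (continuous_const.max continuous_id).log fun u => (lt_max_of_lt_left one_pos).ne'
  fun_prop

theorem logCutoff_nonneg (ε u : ℝ) : 0 ≤ logCutoff ε u := le_max_left _ _

theorem logCutoff_le_one {ε : ℝ} (hε : 0 ≤ ε) (u : ℝ) : logCutoff ε u ≤ 1 :=
  max_le zero_le_one (sub_le_self _ (mul_nonneg hε (Real.log_nonneg (le_max_left _ _))))

theorem logCutoff_of_le_one (ε : ℝ) {u : ℝ} (hu : u ≤ 1) : logCutoff ε u = 1 := by
  simp [logCutoff, max_eq_left hu]

theorem logCutoff_of_exp_le {ε u : ℝ} (hε : 0 < ε) (hu : Real.exp (1 / ε) ≤ u) :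
    logCutoff ε u = 0 := by
  have h : 1 / ε ≤ Real.log (max 1 u) := by
    rw [Real.le_log_iff_exp_le (lt_max_of_lt_left one_pos)]
    exact le_max_of_le_right hu
  rw [div_le_iff₀' hε] at h
  exact max_eq_left (by linarith)

theorem abs_logCutoff_sub_le {ε u₁ u₂ : ℝ} (hε : 0 ≤ ε) (h₁ : 0 < u₁) (h : u₁ ≤ u₂) :
    |logCutoff ε u₁ - logCutoff ε u₂| ≤ ε * (Real.log u₂ - Real.log u₁) := by
  have hlog : ∀ u : ℝ, 0 < u → Real.log (max 1 u) = max 0 (Real.log u) := by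
    intro u hu
    rcases le_total 1 u with h | h
    · rw [max_eq_right h, max_eq_right (Real.log_nonneg h)]
    · rw [max_eq_left h, Real.log_one, max_eq_left (Real.log_nonpos hu.le h)]
  have hle := Real.log_le_log h₁ h
  rw [logCutoff, logCutoff, hlog u₁ h₁, hlog u₂ (h₁.trans_le h), max_comm 0 (1 - _),
    max_comm 0 (1 - _)]
  refine (abs_max_sub_max_le_abs _ _ _).trans ?_
  rw [sub_sub_sub_cancel_left, ← mul_sub, abs_mul, abs_of_nonneg hε, max_comm 0, max_comm 0]
  refine mul_le_mul_of_nonneg_left ((abs_max_sub_max_le_abs _ _ _).trans ?_) hε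
  rw [abs_of_nonneg (sub_nonneg.2 hle)]

/-- Since the slope of the cutoff is small against `1 / |a|`, multiplying the radius `u` by the
factor `exp (a * logCutoff ε u)` does not fold the half-line `[0, ∞)`. -/
theorem strictMonoOn_mul_exp_logCutoff {ε a : ℝ} (hε : 0 ≤ ε) (ha : |a| * ε < 1) :
    StrictMonoOn (fun u => u * Real.exp (a * logCutoff ε u)) (Set.Ici 0) := by
  intro u₁ h₁ u₂ h₂ h
  rcases (Set.mem_Ici.1 h₁).eq_or_lt with rfl | hu₁
  · simpa using mul_pos h (Real.exp_pos _)
  have hu₂ := hu₁.trans h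
  have hlog := Real.log_lt_log hu₁ h
  have hsub : a * (logCutoff ε u₁ - logCutoff ε u₂) < Real.log u₂ - Real.log u₁ :=
    calc a * (logCutoff ε u₁ - logCutoff ε u₂)
        ≤ |a| * |logCutoff ε u₁ - logCutoff ε u₂| := by
          rw [← abs_mul]
          exact le_abs_self _
      _ ≤ |a| * (ε * (Real.log u₂ - Real.log u₁)) :=
          mul_le_mul_of_nonneg_left (abs_logCutoff_sub_le hε hu₁ h.le) (abs_nonneg a)
      _ < Real.log u₂ - Real.log u₁ := by
          rw [← mul_assoc]
          exact mul_lt_of_lt_one_left (sub_pos.2 hlog) ha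
  have hexp : ∀ u : ℝ, 0 < u → u * Real.exp (a * logCutoff ε u) =
      Real.exp (Real.log u + a * logCutoff ε u) := fun u hu => by
    rw [Real.exp_add, Real.exp_log hu]
  simp only [hexp u₁ hu₁, hexp u₂ hu₂, Real.exp_lt_exp]
  linarith

/-- A map of `ℝ × ℂ` that preserves every level `{s} × ℂ`. On a level with `s > 0` it is the
multiplication by `exp (t * L s)` on the disc `‖v‖ ≤ s`, damped to the identity for large
`‖v‖ / s`; on the levels with `s ≤ 0` it is the identity. -/
noncomputable def coneTwist (ε : ℝ) (L : ℝ → ℂ) (t : ℝ) (p : ℝ × ℂ) : ℝ × ℂ :=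
  (p.1, if 0 < p.1 then
    p.2 * Complex.exp (((t * logCutoff ε (‖p.2‖ / p.1) : ℝ) : ℂ) * L p.1) else p.2)

theorem coneTwist_zero (ε : ℝ) (L : ℝ → ℂ) (p : ℝ × ℂ) : coneTwist ε L 0 p = p := by
  simp [coneTwist]

theorem coneTwist_of_nonpos (ε : ℝ) (L : ℝ → ℂ) (t : ℝ) {p : ℝ × ℂ} (hp : p.1 ≤ 0) :
    coneTwist ε L t p = p := by
  rw [coneTwist, if_neg hp.not_gt]

theorem coneTwist_of_norm_le (ε : ℝ) (L : ℝ → ℂ) (t : ℝ) {p : ℝ × ℂ} (hp : 0 < p.1)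
    (h : ‖p.2‖ ≤ p.1) : coneTwist ε L t p = (p.1, p.2 * Complex.exp (t * L p.1)) := by
  rw [coneTwist, if_pos hp, logCutoff_of_le_one ε ((div_le_one hp).2 h), mul_one]

theorem coneTwist_of_le_norm {ε : ℝ} (hε : 0 < ε) (L : ℝ → ℂ) (t : ℝ) {p : ℝ × ℂ}
    (h : Real.exp (1 / ε) * p.1 ≤ ‖p.2‖) : coneTwist ε L t p = p := by
  rcases le_or_gt p.1 0 with hp | hp
  · exact coneTwist_of_nonpos ε L t hp
  · rw [coneTwist, if_pos hp, logCutoff_of_exp_le hε ((le_div_iff₀ hp).2 h)]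
    simp

theorem norm_coneTwist_snd (ε : ℝ) (L : ℝ → ℂ) (t : ℝ) {p : ℝ × ℂ} (hp : 0 < p.1) :
    ‖(coneTwist ε L t p).2‖ =
      p.1 * (‖p.2‖ / p.1 * Real.exp (t * (L p.1).re * logCutoff ε (‖p.2‖ / p.1))) := by
  rw [coneTwist, if_pos hp, norm_mul, Complex.norm_exp, Complex.re_ofReal_mul, ← mul_assoc,
    mul_div_cancel₀ _ hp.ne']
  ring_nf

section

variable {ε M t : ℝ} {L : ℝ → ℂ}

theorem abs_mul_re_mul_logCutoff_le (hε : 0 ≤ ε) (hL : ∀ s, 0 < s → |(L s).re| ≤ M)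
    (ht : |t| ≤ 1) {s : ℝ} (hs : 0 < s) (u : ℝ) : |t * (L s).re * logCutoff ε u| ≤ M := by
  rw [abs_mul, abs_mul, abs_of_nonneg (logCutoff_nonneg ε u)]
  calc |t| * |(L s).re| * logCutoff ε u ≤ 1 * |(L s).re| * 1 := by
        refine mul_le_mul (mul_le_mul_of_nonneg_right ht (abs_nonneg _))
          (logCutoff_le_one hε u) (logCutoff_nonneg ε u) (by positivity)
    _ ≤ M := by simpa using hL s hs

theorem norm_coneTwist_snd_le (hε : 0 ≤ ε) (hM : 0 ≤ M) (hL : ∀ s, 0 < s → |(L s).re| ≤ M)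
    (ht : |t| ≤ 1) (p : ℝ × ℂ) : ‖(coneTwist ε L t p).2‖ ≤ Real.exp M * ‖p.2‖ := by
  rcases le_or_gt p.1 0 with hp | hp
  · rw [coneTwist_of_nonpos ε L t hp]
    exact le_mul_of_one_le_left (norm_nonneg _) (Real.one_le_exp hM)
  · rw [norm_coneTwist_snd ε L t hp, ← mul_assoc, mul_div_cancel₀ _ hp.ne', mul_comm]
    gcongr
    exact (abs_le.1 (abs_mul_re_mul_logCutoff_le hε hL ht hp _)).2

theorem norm_snd_le_norm_coneTwist_snd (hε : 0 ≤ ε) (hM : 0 ≤ M)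
    (hL : ∀ s, 0 < s → |(L s).re| ≤ M) (ht : |t| ≤ 1) (p : ℝ × ℂ) :
    ‖p.2‖ ≤ Real.exp M * ‖(coneTwist ε L t p).2‖ := by
  rcases le_or_gt p.1 0 with hp | hp
  · rw [coneTwist_of_nonpos ε L t hp]
    exact le_mul_of_one_le_left (norm_nonneg _) (Real.one_le_exp hM)
  · rw [norm_coneTwist_snd ε L t hp, ← mul_assoc p.1, mul_div_cancel₀ _ hp.ne', mul_left_comm,
      ← Real.exp_add]
    refine le_mul_of_one_le_right (norm_nonneg _) (Real.one_le_exp ?_)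
    linarith [(abs_le.1 (abs_mul_re_mul_logCutoff_le hε hL ht hp (‖p.2‖ / p.1))).1]

/-- The twist is jointly continuous in the time and the point. Near `(s, v)` with `s ≤ 0` and
`v ≠ 0` it is the identity, and near `(s, 0)` it is controlled by the bound on `re L`, so that
no regularity of `L` at `0` is needed. -/
theorem continuous_coneTwist (hε : 0 < ε) (hM : 0 ≤ M) (hLc : ContinuousOn L (Set.Ioi 0))
    (hL : ∀ s, 0 < s → |(L s).re| ≤ M) :
    Continuous fun q : unitInterval × (ℝ × ℂ) => coneTwist ε L q.1 q.2 := by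
  have habs : ∀ t : unitInterval, |(t : ℝ)| ≤ 1 := fun t => by
    rw [abs_of_nonneg t.2.1]
    exact t.2.2
  rw [continuous_iff_continuousAt]
  rintro ⟨t, s, v⟩
  rcases lt_or_ge 0 s with hs | hs
  · have hev : ∀ᶠ q : unitInterval × (ℝ × ℂ) in 𝓝 (t, s, v),
        (q.2.1, q.2.2 * Complex.exp
          ((((q.1 : ℝ) * logCutoff ε (‖q.2.2‖ / q.2.1) : ℝ) : ℂ) * L q.2.1)) =
          coneTwist ε L q.1 q.2 := by
      have : ∀ᶠ q : unitInterval × (ℝ × ℂ) in 𝓝 (t, s, v), 0 < q.2.1 :=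
        (isOpen_lt continuous_const (by fun_prop)).mem_nhds hs
      filter_upwards [this] with q hq
      rw [coneTwist, if_pos hq]
    refine ContinuousAt.congr ?_ hev
    have hLs : ContinuousAt (fun q : unitInterval × (ℝ × ℂ) => L q.2.1) (t, s, v) :=
      ContinuousAt.comp (f := fun q : unitInterval × (ℝ × ℂ) => q.2.1)
        (hLc.continuousAt (Ioi_mem_nhds hs)) (by fun_prop)
    have hχ : ContinuousAt (fun q : unitInterval × (ℝ × ℂ) => logCutoff ε (‖q.2.2‖ / q.2.1))
        (t, s, v) :=
      (continuous_logCutoff ε).continuousAt.comp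
        (ContinuousAt.div (by fun_prop) (by fun_prop) hs.ne')
    have ht : ContinuousAt (fun q : unitInterval × (ℝ × ℂ) => (q.1 : ℝ)) (t, s, v) :=
      (continuous_subtype_val.comp continuous_fst).continuousAt
    have hexp : ContinuousAt (fun q : unitInterval × (ℝ × ℂ) =>
        (((q.1 : ℝ) * logCutoff ε (‖q.2.2‖ / q.2.1) : ℝ) : ℂ)) (t, s, v) :=
      Complex.continuous_ofReal.continuousAt.comp (ht.mul hχ)
    exact ContinuousAt.prodMk (by fun_prop) (ContinuousAt.mul (by fun_prop)
      (Complex.continuous_exp.continuousAt.comp (hexp.mul hLs)))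
  · rcases eq_or_ne v 0 with rfl | hv
    · refine ContinuousAt.prodMk (by fun_prop) ?_
      have h0 : (coneTwist ε L t (s, 0)).2 = 0 := by simp [coneTwist]
      change Tendsto (fun q : unitInterval × (ℝ × ℂ) => (coneTwist ε L q.1 q.2).2) _
        (𝓝 (coneTwist ε L t (s, 0)).2)
      rw [h0]
      refine squeeze_zero_norm (fun q => norm_coneTwist_snd_le hε.le hM hL (habs q.1) q.2) ?_
      have : Continuous fun q : unitInterval × (ℝ × ℂ) => Real.exp M * ‖q.2.2‖ := by fun_prop
      simpa using this.tendsto (t, s, 0)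
    · have hev : ∀ᶠ q : unitInterval × (ℝ × ℂ) in 𝓝 (t, s, v), q.2 = coneTwist ε L q.1 q.2 := by
        have : ∀ᶠ q : unitInterval × (ℝ × ℂ) in 𝓝 (t, s, v),
            Real.exp (1 / ε) * q.2.1 < ‖q.2.2‖ :=
          (isOpen_lt (by fun_prop) (by fun_prop)).mem_nhds
            ((mul_nonpos_of_nonneg_of_nonpos (Real.exp_pos _).le hs).trans_lt (norm_pos_iff.2 hv))
        filter_upwards [this] with q hq
        exact (coneTwist_of_le_norm hε L _ hq.le).symm
      exact ContinuousAt.congr (by fun_prop) hev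

theorem injective_coneTwist (hε : 0 ≤ ε) (hεM : M * ε < 1) (hL : ∀ s, 0 < s → |(L s).re| ≤ M)
    (ht : |t| ≤ 1) : Function.Injective (coneTwist ε L t) := by
  rintro ⟨s, v⟩ ⟨s', v'⟩ h
  obtain rfl : s = s' := congrArg Prod.fst h
  rcases le_or_gt s 0 with hs | hs
  · rwa [coneTwist_of_nonpos ε L t hs, coneTwist_of_nonpos ε L t hs] at h
  have ha : |t * (L s).re| * ε < 1 := by
    refine lt_of_le_of_lt (mul_le_mul_of_nonneg_right ?_ hε) hεM
    rw [abs_mul]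
    simpa using mul_le_mul ht (hL s hs) (abs_nonneg _) zero_le_one
  have hnorm : ‖v‖ / s = ‖v'‖ / s := by
    have := congrArg (fun p : ℝ × ℂ => ‖p.2‖) h
    simp only [norm_coneTwist_snd ε L t (p := (s, v)) hs,
      norm_coneTwist_snd ε L t (p := (s, v')) hs] at this
    exact (strictMonoOn_mul_exp_logCutoff hε ha).injOn (Set.mem_Ici.2 (by positivity))
      (Set.mem_Ici.2 (by positivity)) (mul_left_cancel₀ hs.ne' this)
  have h₂ := congrArg Prod.snd h
  simp only [coneTwist, if_pos hs, hnorm] at h₂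
  rw [mul_right_cancel₀ (Complex.exp_ne_zero _) h₂]

theorem surjective_coneTwist (hε : 0 ≤ ε) (hL : ∀ s, 0 < s → |(L s).re| ≤ M)
    (ht : |t| ≤ 1) : Function.Surjective (coneTwist ε L t) := by
  rintro ⟨s, z⟩
  rcases le_or_gt s 0 with hs | hs
  · exact ⟨(s, z), coneTwist_of_nonpos ε L t hs⟩
  -- The radius of the preimage comes from the intermediate value theorem.
  obtain ⟨u, hu, hz⟩ : ∃ u, 0 ≤ u ∧
      u * Real.exp (t * (L s).re * logCutoff ε u) = ‖z‖ / s := by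
    have hcont : Continuous fun u => u * Real.exp (t * (L s).re * logCutoff ε u) := by
      have := continuous_logCutoff ε
      fun_prop
    have h0 : 0 ≤ ‖z‖ / s * Real.exp M := by positivity
    have hmem : ‖z‖ / s ∈ Set.Icc (0 * Real.exp (t * (L s).re * logCutoff ε 0))
        (‖z‖ / s * Real.exp M *
          Real.exp (t * (L s).re * logCutoff ε (‖z‖ / s * Real.exp M))) := by
      refine ⟨by rw [zero_mul]; positivity, ?_⟩
      rw [mul_assoc, ← Real.exp_add]
      refine le_mul_of_one_le_right (by positivity) (Real.one_le_exp ?_)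
      linarith [(abs_le.1 (abs_mul_re_mul_logCutoff_le hε hL ht hs (‖z‖ / s * Real.exp M))).1]
    obtain ⟨u, hu, hz⟩ := intermediate_value_Icc h0 hcont.continuousOn hmem
    exact ⟨u, hu.1, hz⟩
  set e : ℂ := Complex.exp (((t * logCutoff ε u : ℝ) : ℂ) * L s) with he
  have hne : ‖e‖ = Real.exp (t * (L s).re * logCutoff ε u) := by
    rw [he, Complex.norm_exp, Complex.re_ofReal_mul]
    ring_nf
  have hnorm : ‖z / e‖ / s = u := by
    rw [norm_div, hne, div_right_comm, ← hz, mul_div_cancel_right₀ _ (Real.exp_pos _).ne']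
  refine ⟨(s, z / e), ?_⟩
  simp only [coneTwist, if_pos hs, hnorm, ← he]
  rw [div_mul_cancel₀ z (Complex.exp_ne_zero _)]

theorem isHomeomorph_coneTwist (hε : 0 < ε) (hM : 0 ≤ M) (hεM : M * ε < 1)
    (hLc : ContinuousOn L (Set.Ioi 0)) (hL : ∀ s, 0 < s → |(L s).re| ≤ M)
    (ht : t ∈ unitInterval) : IsHomeomorph (coneTwist ε L t) := by
  have habs : |t| ≤ 1 := by
    rw [abs_of_nonneg ht.1]
    exact ht.2
  have hcont : Continuous (coneTwist ε L t) :=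
    (continuous_coneTwist hε hM hLc hL).comp
      (Continuous.prodMk_right (⟨t, ht⟩ : unitInterval))
  have hnorm : ∀ p : ℝ × ℂ, ‖p‖ ≤ Real.exp M * ‖coneTwist ε L t p‖ := by
    intro p
    refine max_le ?_ ((norm_snd_le_norm_coneTwist_snd hε.le hM hL habs p).trans ?_)
    · exact (norm_fst_le (coneTwist ε L t p)).trans
        (le_mul_of_one_le_left (norm_nonneg _) (Real.one_le_exp hM))
    · gcongr
      exact norm_snd_le (coneTwist ε L t p)
  -- The lower bound on the norm makes the map proper, hence closed.
  have hproper : IsProperMap (coneTwist ε L t) := by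
    refine isProperMap_iff_tendsto_cocompact.2 ⟨hcont, ?_⟩
    rw [← Metric.cobounded_eq_cocompact, ← tendsto_norm_atTop_iff_cobounded]
    rw [← tendsto_const_mul_atTop_of_pos (Real.exp_pos M)]
    exact tendsto_atTop_mono hnorm tendsto_norm_cobounded_atTop
  exact isHomeomorph_iff_continuous_isClosedMap_bijective.2 ⟨hcont, hproper.isClosedMap,
    injective_coneTwist hε.le hεM hL habs, surjective_coneTwist hε.le hL habs⟩

end

/-! ### Coordinates along the axis -/

/-- Coordinates on `ℝ³` adapted to the wedge: the rescaled distance `s` from the vertex along the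
axis, and the transverse plane as `ℂ` in units of `w`. In them the strands of the wedge are
`(s, s)` and `(s, -s)`, and the half-turn about the axis is `v ↦ -v`. -/
noncomputable def axisCoordinates (l w : ℝ) (hl : l ≠ 0) (hw : w ≠ 0) :
    EuclideanSpace ℝ (Fin 3) ≃ₜ ℝ × ℂ where
  toFun p := (-p 0 / (6 * l), Complex.equivRealProdCLM.symm (w⁻¹ • (p 1, p 2)))
  invFun q := !₂[-6 * l * q.1, w * q.2.re, w * q.2.im]
  left_inv p := by
    ext i
    fin_cases i
    · simp
      field_simp
    · simp [hw]
    · simp [hw]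
  right_inv q := by
    refine Prod.ext ?_ (Complex.ext ?_ ?_)
    · simp
      field_simp
    · simp [hw]
    · simp [hw]
  continuous_toFun := by fun_prop
  continuous_invFun := by fun_prop

/-- A strand as a path in the transverse plane `ℂ`, in units of `w`. -/
noncomputable def complexStrand (w : ℝ) (σ : ℝ → ℝ × ℝ) (s : ℝ) : ℂ :=
  Complex.equivRealProdCLM.symm (w⁻¹ • σ s)

theorem complexStrand_wedgeStrand {w : ℝ} (hw : w ≠ 0) (s : ℝ) :
    complexStrand w (wedgeStrand w) s = s := by
  apply Complex.ext <;> simp [complexStrand, wedgeStrand, hw]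

theorem axisCoordinates_arcOfStrand {l w : ℝ} (hl : l ≠ 0) (hw : w ≠ 0) (σ : ℝ → ℝ × ℝ)
    (t : unitInterval) : axisCoordinates l w hl hw (arcOfStrand l σ t) =
      if (t : ℝ) ≤ 1 / 2 then (2 - 4 * (t : ℝ), complexStrand w σ (2 - 4 * t))
      else (4 * (t : ℝ) - 2, -complexStrand w σ (4 * t - 2)) := by
  unfold arcOfStrand
  split_ifs
  · refine Prod.ext ?_ ?_
    · simp [axisCoordinates]
      field_simp
    · apply Complex.ext <;> simp [axisCoordinates, complexStrand]
  · refine Prod.ext ?_ ?_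
    · simp [axisCoordinates]
      field_simp
    · apply Complex.ext <;> simp [axisCoordinates, complexStrand]

theorem norm_complexStrand_le (w : ℝ) (σ : ℝ → ℝ × ℝ) (s : ℝ) :
    ‖complexStrand w σ s‖ ≤ 2 * |w|⁻¹ * ‖σ s‖ := by
  refine (Complex.norm_le_abs_re_add_abs_im _).trans ?_
  have h₁ := norm_fst_le (w⁻¹ • σ s)
  have h₂ := norm_snd_le (w⁻¹ • σ s)
  rw [norm_smul, norm_inv, Real.norm_eq_abs, Real.norm_eq_abs] at h₁ h₂
  simp only [complexStrand, Complex.equivRealProdCLM_symm_apply_re,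
    Complex.equivRealProdCLM_symm_apply_im]
  linarith

theorem le_norm_complexStrand (w : ℝ) (σ : ℝ → ℝ × ℝ) (s : ℝ) :
    |w|⁻¹ * ‖σ s‖ ≤ ‖complexStrand w σ s‖ := by
  have h : ‖w⁻¹ • σ s‖ ≤ ‖complexStrand w σ s‖ := by
    refine max_le ?_ ?_
    · simpa [complexStrand] using Complex.abs_re_le_norm (complexStrand w σ s)
    · simpa [complexStrand] using Complex.abs_im_le_norm (complexStrand w σ s)
  rwa [norm_smul, norm_inv, Real.norm_eq_abs] at h

/-! ### A continuous logarithm of the strand -/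

/-- A continuous path in `ℂ` on `(0, ∞)` whose norm stays between two positive constants has a
continuous logarithm with bounded real part. The imaginary part may be unbounded: for
the strand with infinitely many twists it counts the half-turns. -/
theorem exists_continuousOn_log {c : ℝ → ℂ} (hc : ContinuousOn c (Set.Ioi 0)) {A B : ℝ}
    (hA : 0 < A) (hle : ∀ s, 0 < s → A ≤ ‖c s‖) (hge : ∀ s, 0 < s → ‖c s‖ ≤ B) :
    ∃ L : ℝ → ℂ, ∃ M : ℝ, 0 ≤ M ∧ ContinuousOn L (Set.Ioi 0) ∧
      (∀ s, 0 < s → |(L s).re| ≤ M) ∧ ∀ s, 0 < s → Complex.exp (L s) = c s := by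
  have hsc : IsSimplyConnected (Set.Ioi (0 : ℝ)) := by
    have := (convex_Ioi (0 : ℝ)).contractibleSpace Set.nonempty_Ioi
    exact (inferInstance : SimplyConnectedSpace (Set.Ioi (0 : ℝ)))
  obtain ⟨L, hLc, hL⟩ := Complex.exists_continuousOn_eqOn_exp_comp hsc isOpen_Ioi hc (by
    rintro ⟨s, hs, h⟩
    have := hle s hs
    rw [h, norm_zero] at this
    exact absurd this (not_le.2 hA))
  refine ⟨L, max |Real.log A| |Real.log B|, by positivity, hLc, fun s hs => ?_, fun s hs => hL hs⟩
  have hre : (L s).re = Real.log ‖c s‖ := by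
    rw [← hL hs, Function.comp_apply, Complex.norm_exp, Real.log_exp]
  have hpos := hA.trans_le (hle s hs)
  rw [hre]
  exact abs_le_max_abs_abs (Real.log_le_log hA (hle s hs)) (Real.log_le_log hpos (hge s hs))

/-! ### The ambient isotopy -/

theorem infiniteStrand_zero (w b : ℝ) : infiniteStrand w b 0 = 0 :=
  norm_le_zero_iff.1 (by simpa using norm_infiniteStrand_le w b le_rfl)

/-- The ambient isotopy from the wedge to the arc with infinitely many twists: the cone around
the wedge is twisted level by level by a continuous logarithm of the strand. -/
theorem ambientIsotopic_startingArc_infiniteTwistArc {l w b : ℝ} (hl : l ≠ 0) (hw : w ≠ 0)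
    (hb : b ≠ 0) : AmbientIsotopic (startingArc l w) (infiniteTwistArc l w b) := by
  set ζ := complexStrand w (infiniteStrand w b) with hζ
  have hζ0 : ζ 0 = 0 := by simp [hζ, complexStrand, infiniteStrand_zero]
  have hw' := abs_pos.2 hw
  have hζc : ContinuousOn ζ (Set.Ioi 0) :=
    Complex.equivRealProdCLM.symm.continuous.comp_continuousOn
      (((continuousOn_infiniteStrand w b).mono Set.Ioi_subset_Ici_self).const_smul w⁻¹)
  obtain ⟨L, M, hM, hLc, hL, hexp⟩ := exists_continuousOn_log (c := fun s => ζ s / s)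
    (A := |w|⁻¹ * (min |w| |b| / 4)) (B := 2 * |w|⁻¹ * (2 * (|w| + |b|)))
    (hζc.div Complex.continuous_ofReal.continuousOn fun s hs => by
      exact_mod_cast (Set.mem_Ioi.1 hs).ne')
    (by positivity)
    (fun s hs => by
      rw [norm_div, Complex.norm_of_nonneg hs.le, le_div_iff₀ hs, mul_assoc]
      exact (mul_le_mul_of_nonneg_left (le_norm_infiniteStrand w b hs.le) (by positivity)).trans
        (le_norm_complexStrand w _ s))
    (fun s hs => by
      rw [norm_div, Complex.norm_of_nonneg hs.le, div_le_iff₀ hs, mul_assoc (2 * |w|⁻¹)]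
      exact (norm_complexStrand_le w _ s).trans
        (mul_le_mul_of_nonneg_left (norm_infiniteStrand_le w b hs.le) (by positivity)))
  have hε : 0 < 1 / (M + 1) := by positivity
  have hεM : M * (1 / (M + 1)) < 1 := by
    rw [mul_one_div, div_lt_one (by positivity)]
    linarith
  -- The slope of the cutoff is chosen small against the bound `M` on the radial stretching.
  set ε := 1 / (M + 1)
  -- Both strands of the wedge, `δ = 1` and `δ = -1`, lie where the cutoff is `1`.
  have hstrand : ∀ s : ℝ, 0 ≤ s → ∀ δ : ℂ, ‖δ‖ = 1 →
      coneTwist ε L 1 (s, δ * s) = (s, δ * ζ s) := by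
    intro s hs δ hδ
    rcases hs.eq_or_lt with rfl | hs
    · rw [coneTwist_of_nonpos ε L 1 le_rfl, hζ0, Complex.ofReal_zero]
    · rw [coneTwist_of_norm_le ε L 1 hs (by simp [hδ, abs_of_pos hs]), Complex.ofReal_one,
        one_mul, hexp s hs, mul_assoc, mul_div_cancel₀ _ (by exact_mod_cast hs.ne')]
  set Φ := axisCoordinates l w hl hw with hΦ
  refine ⟨fun q => Φ.symm (coneTwist ε L q.1 (Φ q.2)), ?_, fun y => ?_, fun t => ?_, fun x => ?_⟩
  · exact Φ.symm.continuous.comp ((continuous_coneTwist hε hM hLc hL).comp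
      (continuous_fst.prodMk (Φ.continuous.comp continuous_snd)))
  · simp [coneTwist_zero]
  · exact Φ.symm.isHomeomorph.comp ((isHomeomorph_coneTwist hε hM hεM hLc hL t.2).comp
      Φ.isHomeomorph)
  · simp only [Homeomorph.symm_apply_eq, startingArc, infiniteTwistArc, hΦ,
      axisCoordinates_arcOfStrand, complexStrand_wedgeStrand hw, ← hζ, Set.Icc.coe_one]
    split_ifs with h
    · simpa using hstrand (2 - 4 * x) (by linarith) 1 (by simp)
    · simpa using hstrand (4 * x - 2) (by linarith) (-1) (by simp)

/-! ### Embeddings and uniform convergence -/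

theorem isEmbedding_startingArc {l w : ℝ} (hl : l ≠ 0) (hw : w ≠ 0) :
    IsEmbedding (startingArc l w) := by
  have hcont : Continuous (startingArc l w) := by
    have := continuous_wedgeStrand w
    unfold startingArc arcOfStrand
    refine Continuous.if_le (by fun_prop) (by fun_prop) continuous_subtype_val
      continuous_const fun t ht => ?_
    rw [ht]
    norm_num [wedgeStrand]
  -- The transverse coordinate of the wedge in the plane `ℂ` is `2 - 4 t`.
  have hcoord : ∀ t : unitInterval,
      (axisCoordinates l w hl hw (startingArc l w t)).2 = ((2 - 4 * t : ℝ) : ℂ) := by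
    intro t
    rw [startingArc, axisCoordinates_arcOfStrand]
    split_ifs
    · exact complexStrand_wedgeStrand hw _
    · simp [complexStrand_wedgeStrand hw]
  refine (hcont.isClosedEmbedding fun t t' h => ?_).isEmbedding
  have h' : ((2 - 4 * t : ℝ) : ℂ) = ((2 - 4 * t' : ℝ) : ℂ) := by rw [← hcoord, h, hcoord]
  rw [Complex.ofReal_inj] at h'
  exact Subtype.ext (by linarith)

theorem dist_euclideanSpace_three_le (x y z y' z' : ℝ) :
    dist !₂[x, y, z] !₂[x, y', z'] ≤ |y - y'| + |z - z'| := by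
  rw [EuclideanSpace.dist_eq, Fin.sum_univ_three, Real.sqrt_le_iff]
  refine ⟨by positivity, ?_⟩
  simp only [Matrix.cons_val, Real.dist_eq, sub_self, sq_abs]
  nlinarith [mul_nonneg (abs_nonneg (y - y')) (abs_nonneg (z - z')), sq_abs (y - y'),
    sq_abs (z - z'), abs_zero (α := ℝ)]

theorem dist_arcOfStrand_le (l : ℝ) (σ σ' : ℝ → ℝ × ℝ) {C : ℝ}
    (h : ∀ s, 0 ≤ s → ‖σ s - σ' s‖ ≤ C) (t : unitInterval) :
    dist (arcOfStrand l σ t) (arcOfStrand l σ' t) ≤ 2 * C := by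
  have key : ∀ s, 0 ≤ s → |(σ s).1 - (σ' s).1| + |(σ s).2 - (σ' s).2| ≤ 2 * C := by
    intro s hs
    have h₁ := (norm_fst_le (σ s - σ' s)).trans (h s hs)
    have h₂ := (norm_snd_le (σ s - σ' s)).trans (h s hs)
    simp only [Prod.fst_sub, Prod.snd_sub, Real.norm_eq_abs] at h₁ h₂
    linarith
  unfold arcOfStrand
  split_ifs with ht
  · exact (dist_euclideanSpace_three_le _ _ _ _ _).trans (key _ (by linarith))
  · refine (dist_euclideanSpace_three_le _ _ _ _ _).trans ?_
    rw [neg_sub_neg, neg_sub_neg, abs_sub_comm, abs_sub_comm (σ' _).2]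
    exact key _ (by linarith)

theorem tendstoUniformly_finiteTwistArc (l w b : ℝ) :
    TendstoUniformly (finiteTwistArc l w b) (infiniteTwistArc l w b) atTop := by
  rw [Metric.tendstoUniformly_iff]
  intro ε hε
  have h : Tendsto (fun n : ℕ => 2 * (4 * (|w| + |b|) * (1 / 2 : ℝ) ^ n)) atTop (𝓝 0) := by
    simpa using ((tendsto_pow_atTop_nhds_zero_of_lt_one (r := (1 / 2 : ℝ)) (by norm_num)
      (by norm_num)).const_mul (4 * (|w| + |b|))).const_mul 2
  filter_upwards [h.eventually_lt_const hε] with n hn t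
  rw [dist_comm]
  exact (dist_arcOfStrand_le l _ _ (fun s hs =>
    norm_nestedStrand_sub_infiniteStrand_le w b n hs) t).trans_lt hn

/-- The time-one map of an ambient isotopy. -/
theorem AmbientIsotopic.ambientHomeomorphic {X Y : Type*} [TopologicalSpace X]
    [TopologicalSpace Y] {f₁ f₂ : X → Y} (h : AmbientIsotopic f₁ f₂) :
    AmbientHomeomorphic f₁ f₂ := by
  obtain ⟨H, hH⟩ := h
  exact ⟨(hH.isHomeomorph 1).homeomorph, hH.one_eq⟩

theorem AmbientHomeomorphic.isEmbedding {X Y : Type*} [TopologicalSpace X]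
    [TopologicalSpace Y] {f₁ f₂ : X → Y} (h : AmbientHomeomorphic f₁ f₂) (hf : IsEmbedding f₁) :
    IsEmbedding f₂ := by
  obtain ⟨e, he⟩ := h
  rw [show f₂ = e ∘ f₁ from funext fun x => (he x).symm]
  exact e.isEmbedding.comp hf

theorem proposition4p4 (l w b : ℝ) (hl : 0 < l) (hw : 0 < w) (hb : b ≠ 0) :
    IsEmbedding (startingArc l w) ∧
    IsEmbedding (infiniteTwistArc l w b) ∧
    TendstoUniformly (finiteTwistArc l w b) (infiniteTwistArc l w b) atTop ∧
    AmbientHomeomorphic (startingArc l w) (infiniteTwistArc l w b) ∧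
    AmbientIsotopic (startingArc l w) (infiniteTwistArc l w b) := by
  have hiso := ambientIsotopic_startingArc_infiniteTwistArc hl.ne' hw.ne' hb
  have hstart := isEmbedding_startingArc hl.ne' hw.ne'
  exact ⟨hstart, hiso.ambientHomeomorphic.isEmbedding hstart,
    tendstoUniformly_finiteTwistArc l w b, hiso.ambientHomeomorphic, hiso⟩
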